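/- Let $\mathbb F$ be an arbitrary field, let $n\ge 2$, and let $(E,\langle\cdot,\cdot\rangle)$ be a symplectic vector space of dimension $2n$ over $\mathbb F$, i.e. $\langle\cdot,\cdot\rangle$ is a nondegenerate alternating bilinear form on $E$. Let $$f:\wedge^nE\to\wedge^{n-2}E,\qquad f(w_1\wedge\cdots\wedge w_n)=\sum_{1\le r<s\le n}\langle w_r,w_s\rangle(-1)^{r+s-1}\,w_1\wedge\cdots\wedge\widehat{w_r}\wedge\cdots\wedge\widehat{w_s}\wedge\cdots\wedge w_n,$$ be the contraction map (the hat means that the factor is omitted), and let $L(n,E)$ be the Lagrangian-Grassmannian of $E$, the set of $n$-dimensional isotropic subspaces of $E$, viewed inside $\mathbb P(\wedge^nE)$ by sending a subspace with basis $w_1,\dots,w_n$ to the class of $w_1\wedge\cdots\wedge w_n$. Suppose that $f$ is surjective and that $G:\wedge^nE\to\wedge^{n-2}E$ is a surjective linear map that vanishes on $L(n,E)$, i.e. $G(w_1\wedge\cdots\wedge w_n)=0$ whenever $w_1,\dots,w_n$ is a basis of a subspace in $L(n,E)$. Then there is a unique linear isomorphism $h:\wedge^{n-2}E\to\wedge^{n-2}E$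 such that $G=h\circ f$. -/

import Mathlib

noncomputable section

namespace SympContraction

variable {F E : Type*} [Field F] [AddCommGroup E] [Module F E]

/-- The increasing enumeration of the complement of `{r, s}` in `Fin n` (for `r < s`). -/
def skip {n : ℕ} (r s : Fin n) (i : Fin (n - 2)) : Fin n :=
  ⟨if i.1 < r.1 then i.1 else if i.1 + 1 < s.1 then i.1 + 1 else i.1 + 2, by
    have h1 := i.2
    have h2 := r.2
    have h3 := s.2
    split_ifs <;> omega⟩

/-- The value of the contraction map on a decomposable vector:
`∑_{r < s} ω(w_r, w_s) (-1)^{r+s-1} w_1 ∧ ⋯ ŵ_r ⋯ ŵ_s ⋯ ∧ w_n`.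
Indices in `Fin n` start at `0`, so the exponent `r + s - 1` reads `r + s + 1` here. -/
def contractionValue (ω : LinearMap.BilinForm F E) (n : ℕ) (w : Fin n → E) : ⋀[F]^(n - 2) E :=
  ∑ r : Fin n, ∑ s ∈ Finset.Ioi r,
    ((-1) ^ (r.1 + s.1 + 1) * ω (w r) (w s)) •
      exteriorPower.ιMulti F (n - 2) (fun i => w (skip r s i))

/-! Helper facts: `contractionValue ω n` is an alternating multilinear map when `ω` is
alternating. -/

theorem contractLeft_ιMulti (d : Module.Dual F E) (n : ℕ) (v : Fin (n + 1) → E) :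
    CliffordAlgebra.contractLeft d (ExteriorAlgebra.ιMulti F (n + 1) v) =
      ∑ s : Fin (n + 1), ((-1) ^ s.1 * d (v s)) •
        ExteriorAlgebra.ιMulti F n (fun i => v (s.succAbove i)) := by
  induction n with
  | zero =>
    simp [ExteriorAlgebra.ιMulti_succ_apply, ExteriorAlgebra.ι, Algebra.algebraMap_eq_smul_one]
  | succ n ih =>
    rw [ExteriorAlgebra.ιMulti_succ_apply, ExteriorAlgebra.ι, CliffordAlgebra.contractLeft_ι_mul,
      ih, Fin.sum_univ_succ (n := n + 1), sub_eq_add_neg, Finset.mul_sum, ← Finset.sum_neg_distrib]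
    congr 1
    · simp [Matrix.vecTail, Function.comp_def]
    · refine Finset.sum_congr rfl fun s _ => ?_
      rw [ExteriorAlgebra.ιMulti_succ_apply, mul_smul_comm, ← neg_smul]
      simp [Matrix.vecTail, Function.comp_def, pow_succ, ExteriorAlgebra.ι]

/-- One step of the recursion `D (v ∧ x) = v ∧ D x + ω(v, ·) ⌋ x`. -/
def stepAux (ω : LinearMap.BilinForm F E) :
    E →ₗ[F] ExteriorAlgebra F E × ExteriorAlgebra F E →ₗ[F] ExteriorAlgebra F E :=
  LinearMap.mk₂ F
    (fun v p => ExteriorAlgebra.ι F v * p.2 + CliffordAlgebra.contractLeft (ω v) p.1)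
    (by intros; simp [add_mul]; abel) (by intros; simp)
    (by intros; simp [mul_add]; abel) (by intros; simp)

theorem stepAux_stepAux (ω : LinearMap.BilinForm F E) (hω : ω.IsAlt) (v : E)
    (x y : ExteriorAlgebra F E) :
    stepAux ω v (ExteriorAlgebra.ι F v * x, stepAux ω v (x, y)) =
      (0 : QuadraticForm F E) v • y := by
  have h : ExteriorAlgebra.ι F v * (ExteriorAlgebra.ι F v * y) = 0 := by
    rw [← mul_assoc, ExteriorAlgebra.ι_sq_zero, zero_mul]
  have h2 := CliffordAlgebra.contractLeft_ι_mul (Q := (0 : QuadraticForm F E)) (d := ω v) v x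
  simp only [stepAux, LinearMap.mk₂_apply]
  rw [mul_add, h]
  erw [h2]
  rw [hω v]
  simp

/-- The contraction by `ω` on the whole exterior algebra. -/
def contractionAlg (ω : LinearMap.BilinForm F E) (hω : ω.IsAlt) :
    ExteriorAlgebra F E →ₗ[F] ExteriorAlgebra F E :=
  CliffordAlgebra.foldr' 0 (stepAux ω) (stepAux_stepAux ω hω) 0

theorem contractionAlg_ι_mul (ω : LinearMap.BilinForm F E) (hω : ω.IsAlt) (v : E)
    (x : ExteriorAlgebra F E) :
    contractionAlg ω hω (ExteriorAlgebra.ι F v * x) =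
      ExteriorAlgebra.ι F v * contractionAlg ω hω x + CliffordAlgebra.contractLeft (ω v) x :=
  CliffordAlgebra.foldr'_ι_mul _ _ _ _ _ _

theorem contractionAlg_one (ω : LinearMap.BilinForm F E) (hω : ω.IsAlt) :
    contractionAlg ω hω 1 = 0 := by
  have := CliffordAlgebra.foldr'_algebraMap (0 : QuadraticForm F E) (stepAux ω)
    (stepAux_stepAux ω hω) 0 1
  simpa [contractionAlg] using this

theorem contractionAlg_ιMulti (ω : LinearMap.BilinForm F E) (hω : ω.IsAlt) (n : ℕ)
    (w : Fin n → E) :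
    contractionAlg ω hω (ExteriorAlgebra.ιMulti F n w) = contractionValue ω n w := by
  have key : ∀ (m : ℕ) (w : Fin (m + 1) → E),
      contractionAlg ω hω (ExteriorAlgebra.ιMulti F (m + 1) w) =
        contractionValue ω (m + 1) w := by
    intro m
    induction m with
    | zero =>
      intro w
      rw [ExteriorAlgebra.ιMulti_succ_apply, contractionAlg_ι_mul]
      simp [contractionAlg_one, contractionValue]
    | succ m ih =>
      intro w
      rw [ExteriorAlgebra.ιMulti_succ_apply, contractionAlg_ι_mul, ih, contractLeft_ιMulti]
      simp only [contractionValue, AddSubmonoidClass.coe_finsetSum, Submodule.coe_smul,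
        exteriorPower.ιMulti_apply_coe]
      rw [Fin.sum_univ_succ (n := m + 1), Fin.sum_Ioi_zero, add_comm]
      simp only [Fin.sum_Ioi_succ]
      congr 1
      · refine Finset.sum_congr rfl fun s _ => ?_
        congr 1
        · simp [Matrix.vecTail, pow_succ]
        · congr 1
          funext i
          simp only [Matrix.vecTail, Function.comp_apply]
          congr 1
          ext
          simp only [skip, Fin.succAbove, Fin.lt_def, Fin.val_succ, Fin.val_castSucc]
          have h0 : ((0 : Fin (m + 1 + 1)) : ℕ) = 0 := rfl
          split_ifs <;> simp <;> omega
      · rw [Finset.mul_sum]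
        refine Finset.sum_congr rfl fun r _ => ?_
        rw [Finset.mul_sum]
        refine Finset.sum_congr rfl fun s hs => ?_
        rw [mul_smul_comm]
        have hrs : r.1 < s.1 := by simpa using hs
        cases m with
        | zero => omega
        | succ m =>
          congr 1
          · have he : r.succ.1 + s.succ.1 + 1 = (r.1 + s.1 + 1) + 2 := by
              simp only [Fin.val_succ]; omega
            simp only [Matrix.vecTail, Function.comp_apply]
            rw [he]
            ring
          · refine Eq.symm ((ExteriorAlgebra.ιMulti_succ_apply
              (fun i : Fin (m + 1) => w (skip r.succ s.succ i))).trans ?_)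
            congr 1
            congr 1
            funext i
            simp only [Matrix.vecTail, Function.comp_apply]
            congr 1
            ext
            simp only [skip, Fin.val_succ]
            split_ifs <;> omega
  cases n with
  | zero =>
    simp [contractionAlg_one, contractionValue]
  | succ m => exact key m w

/-- `contractionValue ω n` as an alternating map in the `n` vectors. -/
def contractionAlternating (ω : LinearMap.BilinForm F E) (hω : ω.IsAlt) (n : ℕ) :
    E [⋀^Fin n]→ₗ[F] ⋀[F]^(n - 2) E where
  toFun := contractionValue ω n
  map_update_add' w i x y := Subtype.ext <| by
    rw [Submodule.coe_add]
    simp only [← contractionAlg_ιMulti ω hω]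
    simp
  map_update_smul' w i c x := Subtype.ext <| by
    rw [Submodule.coe_smul]
    simp only [← contractionAlg_ιMulti ω hω]
    simp
  map_eq_zero_of_eq' w i j h hij := Subtype.ext <| by
    rw [← contractionAlg_ιMulti ω hω, AlternatingMap.map_eq_zero_of_eq _ _ h hij]
    simp

/-- The contraction map `f : ⋀ⁿ E → ⋀ⁿ⁻² E` of an alternating form `ω` (see
`contraction_ιMulti` for its values on decomposable vectors). -/
def contraction (ω : LinearMap.BilinForm F E) (hω : ω.IsAlt) (n : ℕ) :
    ⋀[F]^n E →ₗ[F] ⋀[F]^(n - 2) E :=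
  exteriorPower.alternatingMapLinearEquiv (contractionAlternating ω hω n)

theorem contraction_ιMulti (ω : LinearMap.BilinForm F E) (hω : ω.IsAlt) (n : ℕ)
    (w : Fin n → E) :
    contraction ω hω n (exteriorPower.ιMulti F n w) =
      ∑ r : Fin n, ∑ s ∈ Finset.Ioi r,
        ((-1) ^ (r.1 + s.1 + 1) * ω (w r) (w s)) •
          exteriorPower.ιMulti F (n - 2) (fun i => w (skip r s i)) := by
  rw [contraction, exteriorPower.alternatingMapLinearEquiv_apply_ιMulti]
  rfl

/-- The Lagrangian-Grassmannian `L(n, E)`: the `n`-dimensional isotropic subspaces of `E`. -/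
def lagrangianGrassmannian (ω : LinearMap.BilinForm F E) (n : ℕ) : Set (Submodule F E) :=
  {W | Module.finrank F W = n ∧ ∀ x ∈ W, ∀ y ∈ W, ω x y = 0}

/-- `L(n, E)` under the Plücker embedding: all vectors `w₁ ∧ ⋯ ∧ wₙ` where `w₁, …, wₙ` is a basis
of a subspace in `L(n, E)`, that is, nonzero representatives of the Plücker points of these subspaces. -/
def pluckerLagrangian (ω : LinearMap.BilinForm F E) (n : ℕ) : Set (⋀[F]^n E) :=
  {x | ∃ W ∈ lagrangianGrassmannian ω n, ∃ b : Module.Basis (Fin n) F W,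
    x = exteriorPower.ιMulti F n (fun i => (b i : E))}

end SympContraction

end

/-! It is enough that the Lagrangian points span `ker f`. Then `G` kills `ker f`, so `G = h ∘ f`;
`h` is onto because `G` is, hence bijective by finite dimension, and unique because `f` is onto. The
span lies in `ker f`, whose codimension is C(2n, n-2) since `f` is onto. So the span need only have
codimension at most C(2n, n-2), which `exists_fg_multivectors_le` proves by induction, splitting `V
= V' ⊕ ⟨e, f⟩` with `e, f` a hyperbolic pair. Multiplying an isotropic multivector of `V'` by `e` or
by `f` keeps it isotropic. Multiplying it by `e ∧ f` gives, modulo isotropic multivectors, an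
element of `⋀V'`, already accounted for (`hyperbolic_mul_isotropicMultivectors_le`). The defects add
up by Pascal's rule (`codimBound_add_two`). -/

namespace SympContraction

open ExteriorAlgebra

variable {F E : Type*} [Field F] [AddCommGroup E] [Module F E]

/-! ### Hyperbolic pairs in nondegenerate subspaces -/

section Symplectic

variable [FiniteDimensional F E] {ω : LinearMap.BilinForm F E}

/-- In a subspace on which `ω` is nondegenerate, a subspace of more than half the dimension
contains a hyperbolic pair. -/
theorem exists_hyperbolic_pair (hnd : ω.Nondegenerate) {V X : Submodule F E}
    (hV : Disjoint V (ω.orthogonal V)) (hXV : X ≤ V)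
    (hX : Module.finrank F V < 2 * Module.finrank F X) :
    ∃ e ∈ X, ∃ f ∈ X, ω e f = 1 := by
  by_contra! hne
  have hiso : ∀ x ∈ X, ∀ y ∈ X, ω x y = 0 := by
    intro x hx y hy
    by_contra h0
    exact hne _ (X.smul_mem (ω x y)⁻¹ hx) y hy (by simp [h0])
  -- The sum on the left is direct, so an isotropic `X` would satisfy `2 dim X ≤ dim V`.
  have hle : X ⊔ ω.orthogonal V ≤ ω.orthogonal X :=
    sup_le (fun y hy x hx => hiso x hx y hy) (LinearMap.BilinForm.orthogonal_le hXV)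
  have h1 := Submodule.finrank_mono hle
  have h2 := Submodule.finrank_sup_add_finrank_inf_eq X (ω.orthogonal V)
  rw [(hV.mono_left hXV).eq_bot, finrank_bot,
    LinearMap.BilinForm.finrank_orthogonal hnd] at h2
  rw [LinearMap.BilinForm.finrank_orthogonal hnd] at h1
  have h3 := Submodule.finrank_le V
  have h4 := Submodule.finrank_le X
  omega

/-- A subspace of `V` spanned by few vectors leaves a hyperbolic pair of `V` in its orthogonal. -/
theorem exists_hyperbolic_pair_orthogonal (hnd : ω.Nondegenerate)
    {V : Submodule F E} (hV : Disjoint V (ω.orthogonal V)) {k : ℕ}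
    (hk : 2 * k < Module.finrank F V) (v : Fin k → E) :
    ∃ e ∈ V, ∃ f ∈ V, ω e f = 1 ∧ ∀ i, ω (v i) e = 0 ∧ ω (v i) f = 0 := by
  set W := Submodule.span F (Set.range v)
  have hW : Module.finrank F W ≤ k :=
    (finrank_range_le_card (R := F) v).trans_eq (Fintype.card_fin k)
  -- `V ∩ W^⊥` has dimension at least `dim V - k`, more than half of `dim V`.
  have h1 := Submodule.finrank_sup_add_finrank_inf_eq V (ω.orthogonal W)
  rw [LinearMap.BilinForm.finrank_orthogonal hnd] at h1
  have h2 := Submodule.finrank_le (V ⊔ ω.orthogonal W)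
  have h3 := Submodule.finrank_le W
  obtain ⟨e, he, f, hf, hef⟩ := exists_hyperbolic_pair hnd hV
    (inf_le_left : V ⊓ ω.orthogonal W ≤ V) (by omega)
  exact ⟨e, he.1, f, hf.1, hef, fun i =>
    ⟨he.2 _ (Submodule.subset_span ⟨i, rfl⟩), hf.2 _ (Submodule.subset_span ⟨i, rfl⟩)⟩⟩

/-- A hyperbolic pair splits off from a subspace on which `ω` is nondegenerate. -/
theorem exists_hyperbolic_splitting (hω : ω.IsAlt) (hnd : ω.Nondegenerate)
    {V : Submodule F E} (hV : Disjoint V (ω.orthogonal V)) {l : ℕ}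
    (hl : Module.finrank F V = 2 * (l + 1)) :
    ∃ V' ≤ V, ∃ e ∈ V, ∃ f ∈ V, ω e f = 1 ∧ (∀ x ∈ V', ω e x = 0 ∧ ω f x = 0) ∧
      V ≤ V' ⊔ (F ∙ e) ⊔ (F ∙ f) ∧ Disjoint V' (ω.orthogonal V') ∧
      Module.finrank F V' = 2 * l := by
  obtain ⟨e, he, f, hf, hef⟩ := exists_hyperbolic_pair hnd hV le_rfl (by omega)
  have hfe : ω f e = -1 := by rw [← hω.neg_eq, hef]
  set V' := V ⊓ (LinearMap.ker (ω e) ⊓ LinearMap.ker (ω f)) with hV'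
  have hort : ∀ x ∈ V', ω e x = 0 ∧ ω f x = 0 := fun x hx => ⟨hx.2.1, hx.2.2⟩
  have hdec : ∀ x ∈ V, ∃ y ∈ V', ∃ a b : F, x = y + a • e + b • f := by
    intro x hx
    -- Projection along the hyperbolic plane; the signs come from `ω f e = -1`.
    refine ⟨x + ω f x • e - ω e x • f, ⟨?_, ?_, ?_⟩, -ω f x, ω e x, by module⟩
    · exact V.sub_mem (V.add_mem hx (V.smul_mem _ he)) (V.smul_mem _ hf)
    · simp [hef, hω e]
    · simp [hfe, hω f]
  have hsup : V = V' ⊔ Submodule.span F {e, f} := by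
    apply le_antisymm
    · intro x hx
      obtain ⟨y, hy, a, b, rfl⟩ := hdec x hx
      rw [add_assoc]
      exact Submodule.add_mem_sup hy (Submodule.mem_span_pair.2 ⟨a, b, rfl⟩)
    · refine sup_le inf_le_left (Submodule.span_le.2 ?_)
      rintro x (rfl | rfl) <;> assumption
  refine ⟨V', inf_le_left, e, he, f, hf, hef, hort, ?_, ?_, ?_⟩
  · rw [sup_assoc, ← Submodule.span_union, Set.singleton_union, ← hsup]
  · rw [Submodule.disjoint_def]
    intro x hx hx'
    refine Submodule.disjoint_def.1 hV x hx.1 fun y hy => ?_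
    obtain ⟨z, hz, a, b, rfl⟩ := hdec y hy
    obtain ⟨h1, h2⟩ := hort x hx
    simp [h1, h2, show ω z x = 0 from hx' z hz]
  · have hdis : V' ⊓ Submodule.span F {e, f} = ⊥ := by
      rw [eq_bot_iff]
      rintro x ⟨hx, hx'⟩
      obtain ⟨a, b, rfl⟩ := Submodule.mem_span_pair.1 hx'
      obtain ⟨h1, h2⟩ := hort _ hx
      simp [hef, hfe, hω e, hω f] at h1 h2
      simp [h1, h2]
    have hind : LinearIndependent F ![e, f] := by
      rw [LinearIndependent.pair_iff]
      intro a b h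
      have h1 := congrArg (ω e) h
      have h2 := congrArg (ω f) h
      simp [hef, hfe, hω e, hω f] at h1 h2
      exact ⟨h2, h1⟩
    have h2 := finrank_span_eq_card hind
    have h1 := Submodule.finrank_sup_add_finrank_inf_eq V' (Submodule.span F {e, f})
    rw [← hsup, hdis, finrank_bot] at h1
    rw [Matrix.range_cons_cons_empty, Fintype.card_fin] at h2
    omega

end Symplectic

/-! ### Multivectors of a subspace as powers in the exterior algebra -/

section Algebra

/-- A graded-commutativity expansion of the powers of `M + L` when `L * L = 0`. -/
theorem add_pow_succ_le {A : Type*} [IdemSemiring A] {M L : A} (hL : L * L = 0)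
    (hML : M * L ≤ L * M) (k : ℕ) : (M + L) ^ (k + 1) ≤ M ^ (k + 1) + L * M ^ k := by
  induction k with
  | zero => simp
  | succ k ih =>
    calc (M + L) ^ (k + 1 + 1) = (M + L) * (M + L) ^ (k + 1) := pow_succ' _ _
      _ ≤ (M + L) * (M ^ (k + 1) + L * M ^ k) := by gcongr
      _ = M ^ (k + 1 + 1) + M * L * M ^ k + L * M ^ (k + 1) + L * L * M ^ k := by
        rw [pow_succ' M (k + 1)]; noncomm_ring
      _ ≤ M ^ (k + 1 + 1) + L * M * M ^ k + L * M ^ (k + 1) + L * L * M ^ k := by gcongr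
      _ = M ^ (k + 1 + 1) + L * M ^ (k + 1) := by
        rw [hL, zero_mul, add_zero, mul_assoc, ← pow_succ', add_assoc, add_idem]

/-- The `k`-vectors of a subspace `V` of `E`. -/
def multivectors (V : Submodule F E) (k : ℕ) : Submodule F (ExteriorAlgebra F E) :=
  V.map (ι F) ^ k

/-- The span of the products of `k` pairwise orthogonal vectors of `V`. -/
def isotropicMultivectors (ω : LinearMap.BilinForm F E) (V : Submodule F E) (k : ℕ) :
    Submodule F (ExteriorAlgebra F E) :=
  Submodule.span F {x | ∃ v : Fin k → E, (∀ i, v i ∈ V) ∧ (∀ i j, ω (v i) (v j) = 0) ∧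
    x = ιMulti F k v}

theorem ι_mul_mem_multivectors {V : Submodule F E} {e : E} (he : e ∈ V) {k : ℕ}
    {x : ExteriorAlgebra F E} (hx : x ∈ multivectors V k) :
    ι F e * x ∈ multivectors V (k + 1) := by
  rw [multivectors, pow_succ']
  exact Submodule.mul_mem_mul ⟨e, he, rfl⟩ hx

theorem ιMulti_mem_multivectors {V : Submodule F E} {k : ℕ} {v : Fin k → E}
    (hv : ∀ i, v i ∈ V) : ιMulti F k v ∈ multivectors V k := by
  induction k with
  | zero => simp [multivectors]
  | succ k ih =>
    rw [ιMulti_succ_apply]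
    exact ι_mul_mem_multivectors (hv 0) (ih fun i => hv _)

/-- Since `e ∧ e = 0` and vectors anticommute, a product needs at most one factor `e`, moved to the
front. -/
theorem multivectors_sup_span_singleton_le (V : Submodule F E) (e : E) (k : ℕ) :
    multivectors (V ⊔ F ∙ e) (k + 1) ≤
      multivectors V (k + 1) ⊔ (multivectors V k).map (LinearMap.mulLeft F (ι F e)) := by
  have hmul : (multivectors V k).map (LinearMap.mulLeft F (ι F e)) =
      (F ∙ ι F e) * multivectors V k := by
    ext x
    simp [Submodule.mem_span_singleton_mul]
  rw [hmul]
  have h := add_pow_succ_le (M := V.map (ι F)) (L := F ∙ ι F e)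
    (by simp [Submodule.span_mul_span]) ?_ k
  · simpa [multivectors, Submodule.map_sup, Submodule.map_span] using h
  · rw [Submodule.mul_le]
    rintro _ ⟨x, hx, rfl⟩ y hy
    obtain ⟨c, rfl⟩ := Submodule.mem_span_singleton.1 hy
    have h : ι F x * c • ι F e = ι F e * ι F (-(c • x)) := by
      have := ι_add_mul_swap (R := F) x e
      rw [map_neg, map_smul, mul_neg, mul_smul_comm, mul_smul_comm, ← smul_neg,
        eq_neg_of_add_eq_zero_left this]
    rw [h]
    exact Submodule.mul_mem_mul (Submodule.mem_span_singleton_self _)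
      ⟨_, V.neg_mem (V.smul_mem c hx), rfl⟩

theorem multivectors_mono {V V' : Submodule F E} (h : V ≤ V') (k : ℕ) :
    multivectors V k ≤ multivectors V' k :=
  pow_le_pow_left' (Submodule.map_mono h) k

theorem finrank_multivectors [FiniteDimensional F E] (V : Submodule F E) (k : ℕ) :
    Module.finrank F (multivectors V k) ≤ (Module.finrank F V).choose k := by
  have h : multivectors V k = (⋀[F]^k V).map (ExteriorAlgebra.map V.subtype).toLinearMap := by
    rw [multivectors, exteriorPower, Submodule.map_pow, ← LinearMap.range_comp,
      map_comp_ι, LinearMap.range_comp, Submodule.range_subtype]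
  rw [h, ← exteriorPower.finrank_eq]
  exact Submodule.finrank_map_le _ _

end Algebra

/-! ### Codimension of the isotropic multivectors -/

section Isotropic

variable {ω : LinearMap.BilinForm F E}

theorem ι_mul_ιMulti_mem_isotropicMultivectors (hω : ω.IsAlt) {V : Submodule F E} {k : ℕ}
    {v : Fin k → E} (hv : ∀ i, v i ∈ V) (hvv : ∀ i j, ω (v i) (v j) = 0) {e : E} (he : e ∈ V)
    (hev : ∀ i, ω e (v i) = 0) :
    ι F e * ιMulti F k v ∈ isotropicMultivectors ω V (k + 1) := by
  refine Submodule.subset_span ⟨Fin.cons e v, ?_, ?_, ?_⟩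
  · exact fun i => Fin.cases he hv i
  · intro i j
    refine Fin.cases ?_ (fun i => ?_) i <;> refine Fin.cases ?_ (fun j => ?_) j
    · exact hω e
    · exact hev j
    · exact hω.eq_iff.1 (hev i)
    · exact hvv i j
  · rw [ιMulti_succ_apply]
    rfl

theorem isotropicMultivectors_mono {V V' : Submodule F E} (h : V ≤ V') (k : ℕ) :
    isotropicMultivectors ω V k ≤ isotropicMultivectors ω V' k :=
  Submodule.span_mono fun _ ⟨v, hv, hvv, hx⟩ => ⟨v, fun i => h (hv i), hvv, hx⟩

theorem multivectors_zero_le (V : Submodule F E) :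
    multivectors V 0 ≤ isotropicMultivectors ω V 0 := by
  rw [multivectors, pow_zero, Submodule.one_eq_span, Submodule.span_singleton_le_iff_mem]
  exact Submodule.subset_span ⟨Fin.elim0, fun i => i.elim0, fun i => i.elim0, by simp⟩

theorem multivectors_one_le (hω : ω.IsAlt) (V : Submodule F E) :
    multivectors V 1 ≤ isotropicMultivectors ω V 1 := by
  rw [multivectors, pow_one]
  rintro _ ⟨x, hx, rfl⟩
  exact Submodule.subset_span ⟨fun _ => x, fun _ => hx, fun _ _ => hω x, by
    simp [ιMulti_succ_apply]⟩

theorem map_mulLeft_isotropicMultivectors_le (hω : ω.IsAlt) {V V' : Submodule F E} (hV : V' ≤ V)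
    {e : E} (he : e ∈ V) (hort : ∀ x ∈ V', ω e x = 0) (k : ℕ) :
    (isotropicMultivectors ω V' k).map (LinearMap.mulLeft F (ι F e)) ≤
      isotropicMultivectors ω V (k + 1) := by
  rw [isotropicMultivectors, Submodule.map_span_le]
  rintro _ ⟨v, hv, hvv, rfl⟩
  exact ι_mul_ιMulti_mem_isotropicMultivectors hω (fun i => hV (hv i)) hvv he
    fun i => hort _ (hv i)

/-- The product of a hyperbolic pair orthogonal to `V'` with an isotropic multivector of `V'` is,
up to isotropic multivectors, a multivector of `V'`: exchange the pair with one inside `V'`. -/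
theorem hyperbolic_mul_isotropicMultivectors_le [FiniteDimensional F E] (hω : ω.IsAlt)
    (hnd : ω.Nondegenerate) {V V' : Submodule F E} (hV : V' ≤ V)
    (hV' : Disjoint V' (ω.orthogonal V')) {k : ℕ} (hk : 2 * k < Module.finrank F V')
    {e f : E} (he : e ∈ V) (hf : f ∈ V) (hef : ω e f = 1)
    (hort : ∀ x ∈ V', ω e x = 0 ∧ ω f x = 0) :
    (isotropicMultivectors ω V' k).map (LinearMap.mulLeft F (ι F e * ι F f)) ≤
      isotropicMultivectors ω V (k + 2) ⊔ multivectors V' (k + 2) := by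
  rw [isotropicMultivectors, Submodule.map_span_le]
  rintro _ ⟨v, hv, hvv, rfl⟩
  obtain ⟨p, hp, q, hq, hpq, hvpq⟩ := exists_hyperbolic_pair_orthogonal hnd hV' hk v
  have hqp : ω q p = -1 := by rw [← hω.neg_eq, hpq]
  have key : ∀ a ∈ V, ∀ b ∈ V, (∀ i, ω a (v i) = 0) → (∀ i, ω b (v i) = 0) → ω a b = 0 →
      ι F a * (ι F b * ιMulti F k v) ∈ isotropicMultivectors ω V (k + 2) := by
    intro a ha b hb hav hbv hab
    have hmem := ι_mul_ιMulti_mem_isotropicMultivectors hω (v := Fin.cons b v) (V := V) (e := a)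
      (fun i => Fin.cases hb (fun i => hV (hv i)) i) ?_ ha
      (fun i => Fin.cases hab hav i)
    · rwa [ιMulti_succ_apply] at hmem
    · intro i j
      refine Fin.cases ?_ (fun i => ?_) i <;> refine Fin.cases ?_ (fun j => ?_) j
      · exact hω b
      · exact hbv j
      · exact hω.eq_iff.1 (hbv i)
      · exact hvv i j
  have hev := fun i => (hort _ (hv i)).1
  have hfv := fun i => (hort _ (hv i)).2
  have hpv := fun i => hω.eq_iff.1 (hvpq i).1
  have hqv := fun i => hω.eq_iff.1 (hvpq i).2
  -- The exchange: `ω (e + q) (f + p) = ω e f + ω q p = 1 - 1 = 0`. Expanding the product expresses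
  -- `e ∧ f` through isotropic pairs and `-(q ∧ p)`, which lies over `V'`.
  have h1 := key (e + q) (V.add_mem he (hV hq)) (f + p) (V.add_mem hf (hV hp))
    (fun i => by simp [hev, hqv]) (fun i => by simp [hfv, hpv])
    (by simp [hef, hqp, (hort p hp).1, hω.eq_iff.1 (hort q hq).2])
  have h2 := key e he p (hV hp) hev hpv (hort p hp).1
  have h3 := key q (hV hq) f hf hqv hfv (hω.eq_iff.1 (hort q hq).2)
  have h4 : ι F q * (ι F p * ιMulti F k v) ∈ multivectors V' (k + 2) :=
    ι_mul_mem_multivectors hq (ι_mul_mem_multivectors hp (ιMulti_mem_multivectors hv))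
  have heq : LinearMap.mulLeft F (ι F e * ι F f) (ιMulti F k v) =
      (ι F (e + q) * (ι F (f + p) * ιMulti F k v) - ι F e * (ι F p * ιMulti F k v) -
        ι F q * (ι F f * ιMulti F k v)) + -(ι F q * (ι F p * ιMulti F k v)) := by
    simp only [LinearMap.mulLeft_apply, map_add]
    noncomm_ring
  rw [heq]
  exact Submodule.add_mem_sup (sub_mem (sub_mem h1 h2) h3) (neg_mem h4)

/-- An upper bound for the codimension of the isotropic `k`-vectors in the `k`-vectors of an
`m`-dimensional symplectic space, for `2 * k ≤ m + 2`. -/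
def codimBound (m : ℕ) : ℕ → ℕ
  | 0 => 0
  | 1 => 0
  | k + 2 => m.choose k

/-- Pascal's rule applied twice. The terms match the parts of a multivector that contain neither,
exactly one, or both vectors of the split-off pair. -/
theorem codimBound_add_two (m k : ℕ) :
    codimBound m (k + 2) + (codimBound m (k + 1) + codimBound m (k + 1)) + codimBound m k =
      codimBound (m + 2) (k + 2) := by
  rcases k with _ | _ | k
  · simp [codimBound]
  · simp [codimBound]
  · simp only [codimBound, Nat.choose_succ_succ']
    ring

/-- The range of `k` goes one past the middle degree because degree `l + 1` in dimension `2 * (l +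
1)` calls on degree `l + 1` in dimension `2 * l`. `T.FG` supplies the finiteness needed to bound
dimensions of sums. -/
theorem exists_fg_multivectors_le [FiniteDimensional F E] (hω : ω.IsAlt)
    (hnd : ω.Nondegenerate) (l : ℕ) (V : Submodule F E) (hV : Disjoint V (ω.orthogonal V))
    (hl : Module.finrank F V = 2 * l) (k : ℕ) (hk : k ≤ l + 1) :
    ∃ T : Submodule F (ExteriorAlgebra F E), T.FG ∧ Module.finrank F T ≤ codimBound (2 * l) k ∧
      multivectors V k ≤ isotropicMultivectors ω V k ⊔ T := by
  induction l generalizing V k with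
  | zero =>
    refine ⟨⊥, Submodule.fg_bot, by simp, ?_⟩
    rw [sup_bot_eq]
    rcases k with _ | _ | k
    · exact multivectors_zero_le V
    · exact multivectors_one_le hω V
    · omega
  | succ l ih =>
    rcases k with _ | _ | k
    · exact ⟨⊥, Submodule.fg_bot, by simp, by
        rw [sup_bot_eq]; exact multivectors_zero_le V⟩
    · exact ⟨⊥, Submodule.fg_bot, by simp, by
        rw [sup_bot_eq]; exact multivectors_one_le hω V⟩
    -- In the extreme degree `k + 2 = l + 2` the induction hypothesis is out of reach, but all
    -- multivectors may go into `T`: C(2l+2, l+2) = C(2l+2, l).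
    obtain hk' | hk' := Nat.lt_or_ge l (k + 1)
    · refine ⟨multivectors V (k + 2), ?_, ?_, le_sup_right⟩
      · exact (((IsNoetherian.noetherian V).map _).pow _)
      · refine (finrank_multivectors V _).trans_eq ?_
        rw [hl, codimBound]
        exact Nat.choose_symm_of_eq_add (by omega)
    obtain ⟨V', hV'V, e, he, f, hf, hef, hort, hsup, hV', hl'⟩ :=
      exists_hyperbolic_splitting hω hnd hV hl
    obtain ⟨T₁, hT₁, hd₁, h₁⟩ := ih V' hV' hl' (k + 2) (by omega)
    obtain ⟨T₂, hT₂, hd₂, h₂⟩ := ih V' hV' hl' (k + 1) (by omega)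
    obtain ⟨T₃, hT₃, hd₃, h₃⟩ := ih V' hV' hl' k (by omega)
    have := Module.Finite.iff_fg.2 hT₁
    have := Module.Finite.iff_fg.2 hT₂
    have := Module.Finite.iff_fg.2 hT₃
    set Te := T₂.map (LinearMap.mulLeft F (ι F e))
    set Tf := T₂.map (LinearMap.mulLeft F (ι F f))
    set Tfe := T₃.map (LinearMap.mulLeft F (ι F e * ι F f))
    refine ⟨T₁ ⊔ (Te ⊔ Tf) ⊔ Tfe, ?_, ?_, ?_⟩
    · exact (hT₁.sup ((hT₂.map _).sup (hT₂.map _))).sup (hT₃.map _)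
    · rw [show 2 * (l + 1) = 2 * l + 2 by ring, ← codimBound_add_two]
      refine (Submodule.finrank_add_le_finrank_add_finrank _ _).trans (add_le_add
        ((Submodule.finrank_add_le_finrank_add_finrank _ _).trans (add_le_add hd₁
          ((Submodule.finrank_add_le_finrank_add_finrank _ _).trans (add_le_add
            ((Submodule.finrank_map_le _ _).trans hd₂)
            ((Submodule.finrank_map_le _ _).trans hd₂)))))
        ((Submodule.finrank_map_le _ _).trans hd₃))
    set R := isotropicMultivectors ω V (k + 2) ⊔ (T₁ ⊔ (Te ⊔ Tf) ⊔ Tfe) with hR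
    have hUR : isotropicMultivectors ω V (k + 2) ≤ R := le_sup_left
    have hTR : T₁ ⊔ (Te ⊔ Tf) ⊔ Tfe ≤ R := le_sup_right
    simp only [sup_le_iff] at hTR
    obtain ⟨⟨hT₁R, hTeR, hTfR⟩, hTfeR⟩ := hTR
    have r₁ : multivectors V' (k + 2) ≤ R :=
      h₁.trans (sup_le ((isotropicMultivectors_mono hV'V _).trans hUR) hT₁R)
    have r₂ : ∀ a ∈ V, (∀ x ∈ V', ω a x = 0) → T₂.map (LinearMap.mulLeft F (ι F a)) ≤ R →
        (multivectors V' (k + 1)).map (LinearMap.mulLeft F (ι F a)) ≤ R := by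
      intro a ha hax hTa
      refine (Submodule.map_mono h₂).trans ?_
      rw [Submodule.map_sup]
      exact sup_le ((map_mulLeft_isotropicMultivectors_le hω hV'V ha hax _).trans hUR) hTa
    -- The exchange leaves a term in `multivectors V' (k + 2)`, absorbed by `r₁`; only `T₃` adds to
    -- the complement.
    have r₃ : (multivectors V' k).map (LinearMap.mulLeft F (ι F e * ι F f)) ≤ R := by
      refine (Submodule.map_mono h₃).trans ?_
      rw [Submodule.map_sup]
      exact sup_le ((hyperbolic_mul_isotropicMultivectors_le hω hnd hV'V hV' (by omega) he hf hef
        hort).trans (sup_le hUR r₁)) hTfeR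
    refine (multivectors_mono hsup _).trans ((multivectors_sup_span_singleton_le _ _ _).trans
      (sup_le ((multivectors_sup_span_singleton_le _ _ _).trans (sup_le r₁
        (r₂ e he (fun x hx => (hort x hx).1) hTeR))) ?_))
    refine (Submodule.map_mono (multivectors_sup_span_singleton_le _ _ _)).trans ?_
    rw [Submodule.map_sup, ← Submodule.map_comp]
    refine sup_le (r₂ f hf (fun x hx => (hort x hx).2) hTfR) ?_
    have hanti : LinearMap.mulLeft F (ι F f) ∘ₗ LinearMap.mulLeft F (ι F e) =
        -LinearMap.mulLeft F (ι F e * ι F f) := by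
      ext x
      have := eq_neg_of_add_eq_zero_left (ι_add_mul_swap (R := F) f e)
      simp [← mul_assoc, this]
    rw [hanti, Submodule.map_neg]
    exact r₃

end Isotropic


/-! ### The Lagrangian span equals the kernel of the contraction -/

section Lagrangian

variable {ω : LinearMap.BilinForm F E}

theorem contraction_eq_zero_of_mem_pluckerLagrangian (hω : ω.IsAlt) {n : ℕ} {x : ⋀[F]^n E}
    (hx : x ∈ pluckerLagrangian ω n) : contraction ω hω n x = 0 := by
  obtain ⟨W, hW, b, rfl⟩ := hx
  rw [contraction_ιMulti]
  refine Finset.sum_eq_zero fun r _ => Finset.sum_eq_zero fun s _ => ?_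
  rw [hW.2 _ (b r).2 _ (b s).2, mul_zero, zero_smul]

/-- An independent isotropic `n`-tuple is a basis of a Lagrangian subspace; a dependent one has zero
wedge. -/
theorem isotropicMultivectors_le_map_span_pluckerLagrangian (V : Submodule F E) (n : ℕ) :
    isotropicMultivectors ω V n ≤
      (Submodule.span F (pluckerLagrangian ω n)).map (⋀[F]^n E).subtype := by
  refine Submodule.span_le.2 ?_
  rintro _ ⟨v, -, hvv, rfl⟩
  by_cases hv : LinearIndependent F v
  · refine ⟨exteriorPower.ιMulti F n v, Submodule.subset_span ?_, rfl⟩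
    refine ⟨Submodule.span F (Set.range v), ⟨?_, ?_⟩, Module.Basis.span hv, ?_⟩
    · rw [finrank_span_eq_card hv, Fintype.card_fin]
    · intro x hx y hy
      induction hx, hy using Submodule.span_induction₂ with
      | mem_mem x y hx hy =>
        obtain ⟨i, rfl⟩ := hx
        obtain ⟨j, rfl⟩ := hy
        exact hvv i j
      | zero_left => simp
      | zero_right => simp
      | add_left => simp [*]
      | add_right => simp [*]
      | smul_left => simp [*]
      | smul_right => simp [*]
    · simp [Module.Basis.span_apply]
  · rw [SetLike.mem_coe, AlternatingMap.map_linearDependent _ v hv]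
    exact zero_mem _

/-- If the contraction is onto, its kernel is spanned by the Lagrangian-Grassmannian. -/
theorem ker_contraction_le_span_pluckerLagrangian (hω : ω.IsAlt) (hnd : ω.Nondegenerate)
    {n : ℕ} (hn : 2 ≤ n) (hdim : Module.finrank F E = 2 * n)
    (hf : Function.Surjective (contraction ω hω n)) :
    LinearMap.ker (contraction ω hω n) ≤ Submodule.span F (pluckerLagrangian ω n) := by
  have : FiniteDimensional F E := FiniteDimensional.of_finrank_pos (by omega)
  set S := Submodule.span F (pluckerLagrangian ω n)
  have hS : S ≤ LinearMap.ker (contraction ω hω n) := Submodule.span_le.2 fun x hx =>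
    contraction_eq_zero_of_mem_pluckerLagrangian hω hx
  have htop : Disjoint (⊤ : Submodule F E) (ω.orthogonal ⊤) := by
    rw [LinearMap.BilinForm.orthogonal_top_eq_bot hnd]
    exact disjoint_bot_right
  obtain ⟨T, hT, hd, hle⟩ := exists_fg_multivectors_le hω hnd n ⊤ htop
    (by rw [finrank_top, hdim]) n (by omega)
  have := Module.Finite.iff_fg.2 hT
  have h1 : ⋀[F]^n E ≤ S.map (⋀[F]^n E).subtype ⊔ T := by
    refine le_trans ?_ (hle.trans (sup_le_sup_right
      (isotropicMultivectors_le_map_span_pluckerLagrangian ⊤ n) T))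
    rw [multivectors, Submodule.map_top]
  have h2 := (Submodule.finrank_mono h1).trans (Submodule.finrank_add_le_finrank_add_finrank _ _)
  have h3 := Submodule.finrank_map_le (⋀[F]^n E).subtype S
  have h4 := LinearMap.finrank_range_add_finrank_ker (contraction ω hω n)
  rw [LinearMap.range_eq_top.2 hf, finrank_top, exteriorPower.finrank_eq, hdim] at h4
  have h5 : codimBound (2 * n) n = (2 * n).choose (n - 2) := by
    obtain ⟨k, rfl⟩ := Nat.exists_eq_add_of_le' hn
    rfl
  -- `dim S ≥ C(2n, n) - C(2n, n-2) = dim ker f`.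
  exact (Submodule.eq_of_le_of_finrank_le hS (by omega)).ge

end Lagrangian

end SympContraction

/-! ### Factoring `G` through the contraction -/

theorem mainTheorem8 {F E : Type*} [Field F] [AddCommGroup E] [Module F E]
    (ω : LinearMap.BilinForm F E) (hω : ω.IsAlt) (hnd : ω.Nondegenerate)
    (n : ℕ) (hn : 2 ≤ n) (hdim : Module.finrank F E = 2 * n)
    (hf : Function.Surjective (SympContraction.contraction ω hω n))
    (G : ⋀[F]^n E →ₗ[F] ⋀[F]^(n - 2) E) (hG : Function.Surjective G)
    (hGL : ∀ x ∈ SympContraction.pluckerLagrangian ω n, G x = 0) :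
    ∃! h : (⋀[F]^(n - 2) E) ≃ₗ[F] (⋀[F]^(n - 2) E),
      G = h.toLinearMap ∘ₗ SympContraction.contraction ω hω n := by
  have : FiniteDimensional F E := FiniteDimensional.of_finrank_pos (by omega)
  have hker : LinearMap.ker (SympContraction.contraction ω hω n) ≤ LinearMap.ker G :=
    (SympContraction.ker_contraction_le_span_pluckerLagrangian hω hnd hn hdim hf).trans
      (Submodule.span_le.2 hGL)
  -- With a linear section `g` of `f`, the candidate is `h = G ∘ g`; `g (f x) - x` lies in `ker f`,
  -- hence in `ker G`.
  obtain ⟨g, hg⟩ := LinearMap.exists_rightInverse_of_surjective _ (LinearMap.range_eq_top.2 hf)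
  have hgG : (G ∘ₗ g) ∘ₗ SympContraction.contraction ω hω n = G := by
    refine LinearMap.ext fun x => ?_
    rw [← sub_eq_zero]
    simp only [LinearMap.coe_comp, Function.comp_apply, ← map_sub]
    refine hker ?_
    rw [LinearMap.mem_ker, map_sub, sub_eq_zero]
    exact LinearMap.congr_fun hg _
  have hsurj : Function.Surjective (G ∘ₗ g) := by
    refine Function.Surjective.of_comp (g := SympContraction.contraction ω hω n) ?_
    rw [← LinearMap.coe_comp, hgG]
    exact hG
  refine ⟨LinearEquiv.ofBijective (G ∘ₗ g)
    ⟨LinearMap.injective_iff_surjective.2 hsurj, hsurj⟩, ?_, ?_⟩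
  · refine LinearMap.ext fun x => ?_
    exact (LinearMap.congr_fun hgG x).symm
  · intro h hh
    ext1 y
    obtain ⟨x, rfl⟩ := hf y
    exact (LinearMap.congr_fun hh x).symm.trans (LinearMap.congr_fun hgG x).symm
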